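/- For $\alpha\in\mathbb R$ and $n\in\mathbb N$ let $L_n^\alpha(x)=\sum_{j=0}^n\frac{(-x)^j}{j!}\binom{n+\alpha}{n-j}$ be the Laguerre polynomials. Let $F=(F_1,F_2)$ be a pair of finite (possibly empty) sets of positive integers, let $k_i$ be the number of elements of $F_i$, $k=k_1+k_2$, and put $$u_F=\sum_{f\in F_1}f+\sum_{f\in F_2}f-\binom{k_1+1}{2}-\binom{k_2}{2},\qquad \sigma_F=\{u_F,u_F+1,u_F+2,\dots\}\setminus\{u_F+f: f\in F_1\}.$$ Let $\hat\alpha\in\{-1,-2,\dots\}$ be a negative integer. Let $\Omega_F^{\hat\alpha}(x)$ be the $k\times k$ determinant whose rows are $\big((L_f^{\hat\alpha})^{(j-1)}(x)\big)_{1\le j\le k}$ for $f\in F_1$, followed by $\big(L_f^{\hat\alpha+j-1}(-x)\big)_{1\le j\le k}$ for $f\in F_2$, the elements of each $F_i$ being taken in increasing order. For $n\in\sigma_F$ let $L_n^{\hat\alpha;F}(x)$ be the $(k+1)\times(k+1)$ determinant whose first row is $\big((L_{n-u_F}^{\hat\alpha})^{(j-1)}(x)\big)_{1\le j\le k+1}$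 and whose other rows are $\big((L_f^{\hat\alpha})^{(j-1)}(x)\big)_{1\le j\le k+1}$, $f\in F_1$, followed by $\big(L_f^{\hat\alpha+j-1}(-x)\big)_{1\le j\le k+1}$, $f\in F_2$. Then $\Omega_F^{\hat\alpha}$ is not the zero polynomial, and the polynomials $L_n^{\hat\alpha;F}$, $n\in\sigma_F$, are common eigenfunctions of the second order differential operator $D_F=x\partial^2+h_1(x)\partial+h_0(x)$, where $\partial=d/dx$ and $$h_1(x)=\hat\alpha+k+1-x-2x\frac{(\Omega_F^{\hat\alpha})'(x)}{\Omega_F^{\hat\alpha}(x)},$$ $$h_0(x)=-k_1-u_F+(x-\hat\alpha-k)\frac{(\Omega_F^{\hat\alpha})'(x)}{\Omega_F^{\hat\alpha}(x)}+x\frac{(\Omega_F^{\hat\alpha})''(x)}{\Omega_F^{\hat\alpha}(x)}.$$ More precisely, for every $n\in\sigma_F$ the polynomial $L_n^{\hat\alpha;F}$ is not identically zero, and $D_F(L_n^{\hat\alpha;F})(x)=-n\,L_n^{\hat\alpha;F}(x)$ for all real $x$ with $\Omega_F^{\hat\alpha}(x)\neq0$. -/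

import Mathlib

open Polynomial

noncomputable section

/-- The Laguerre polynomial `L_n^α(x) = ∑_{j=0}^n ((-x)^j / j!) * binom(n + α, n - j)`,
with the generalized binomial coefficient. -/
def laguerrePoly (α : ℝ) (n : ℕ) : ℝ[X] :=
  ∑ j ∈ Finset.range (n + 1),
    C (Ring.choose ((n : ℝ) + α) (n - j) / (j.factorial : ℝ)) * (-X) ^ j

/-- The number `u_F = ∑_{F₁} f + ∑_{F₂} f - binom(k₁ + 1, 2) - binom(k₂, 2)`.
For sets of positive integers the subtraction never truncates (`uIndex_add`). -/
def uIndex (F₁ F₂ : Finset ℕ) : ℕ :=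
  (∑ f ∈ F₁, f) + (∑ f ∈ F₂, f) - (F₁.card + 1).choose 2 - F₂.card.choose 2

theorem choose_card_le_sum (F : Finset ℕ) (hF : ∀ f ∈ F, 0 < f) :
    (F.card + 1).choose 2 ≤ ∑ f ∈ F, f := by
  induction F using Finset.induction_on_max with
  | empty => simp
  | insert a s hs ih =>
    have ha : a ∉ s := fun h => lt_irrefl _ (hs a h)
    have h1 := ih (fun f hf => hF f (Finset.mem_insert_of_mem hf))
    have h2 : s.card ≤ a - 1 := by
      have hsub : s ⊆ Finset.Ioo 0 a := fun f hf =>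
        Finset.mem_Ioo.2 ⟨hF f (Finset.mem_insert_of_mem hf), hs f hf⟩
      simpa using Finset.card_le_card hsub
    have h3 : 0 < a := hF a (Finset.mem_insert_self a s)
    have h4 : (s.card + 1 + 1).choose 2 = (s.card + 1) + (s.card + 1).choose 2 := by
      rw [Nat.choose_succ_succ' (s.card + 1) 1, Nat.choose_one_right]
    rw [Finset.card_insert_of_notMem ha, Finset.sum_insert ha, h4]
    omega

theorem uIndex_add (F₁ F₂ : Finset ℕ) (h₁ : ∀ f ∈ F₁, 0 < f) (h₂ : ∀ f ∈ F₂, 0 < f) :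
    uIndex F₁ F₂ + (F₁.card + 1).choose 2 + F₂.card.choose 2
      = (∑ f ∈ F₁, f) + ∑ f ∈ F₂, f := by
  have a := choose_card_le_sum F₁ h₁
  have b := choose_card_le_sum F₂ h₂
  have c : F₂.card.choose 2 ≤ (F₂.card + 1).choose 2 :=
    Nat.choose_le_choose 2 (Nat.le_succ _)
  unfold uIndex
  omega

/-- The index set `σ_F = {u_F, u_F + 1, …} \ {u_F + f : f ∈ F₁}`. -/
def sigmaIndex (F₁ F₂ : Finset ℕ) : Set ℕ :=
  {n | uIndex F₁ F₂ ≤ n} \ {n | ∃ f ∈ F₁, n = uIndex F₁ F₂ + f}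

/-- The rows indexed by `F₁` and then `F₂` (elements in increasing order), with columns
numbered from `0`: the entry in column `j` is `(L_f^α)^{(j)}(x)` for `f ∈ F₁` and
`L_f^{α + j}(-x)` for `f ∈ F₂`. -/
def pairRows (α : ℝ) (F₁ F₂ : Finset ℕ) : Fin (F₁.card + F₂.card) → ℕ → ℝ[X] :=
  Fin.append
    (fun i j => derivative^[j] (laguerrePoly α (F₁.orderEmbOfFin rfl i)))
    (fun i j => (laguerrePoly (α + (j : ℝ)) (F₂.orderEmbOfFin rfl i)).comp (-X))

/-- The polynomial `Ω_F^α`. -/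
def omegaPoly (α : ℝ) (F₁ F₂ : Finset ℕ) : ℝ[X] :=
  Matrix.det (Matrix.of fun i j : Fin (F₁.card + F₂.card) => pairRows α F₁ F₂ i (j : ℕ))

/-- The polynomial `L_n^{α;F}` (meaningful for `n ∈ σ_F`): the first row of the determinant is
`(L_{n - u_F}^α)^{(j)}(x)`, `0 ≤ j ≤ k`, and the others are those of `pairRows`. -/
def exceptionalLaguerre (α : ℝ) (F₁ F₂ : Finset ℕ) (n : ℕ) : ℝ[X] :=
  Matrix.det (Matrix.of fun i j : Fin (F₁.card + F₂.card + 1) =>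
    (Fin.cons (fun l : ℕ => derivative^[l] (laguerrePoly α (n - uIndex F₁ F₂)))
      (pairRows α F₁ F₂) : Fin (F₁.card + F₂.card + 1) → ℕ → ℝ[X]) i (j : ℕ))

/-- The coefficient `h₁ = α + k + 1 - x - 2 x Ω' / Ω`. -/
def coeffOne (α : ℝ) (F₁ F₂ : Finset ℕ) (x : ℝ) : ℝ :=
  α + ((F₁.card + F₂.card : ℕ) : ℝ) + 1 - x
    - 2 * x * ((derivative (omegaPoly α F₁ F₂)).eval x / (omegaPoly α F₁ F₂).eval x)

/-- The coefficient `h₀ = -k₁ - u_F + (x - α - k) Ω' / Ω + x Ω'' / Ω`. -/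
def coeffZero (α : ℝ) (F₁ F₂ : Finset ℕ) (x : ℝ) : ℝ :=
  -(F₁.card : ℝ) - (uIndex F₁ F₂ : ℝ)
    + (x - α - ((F₁.card + F₂.card : ℕ) : ℝ))
      * ((derivative (omegaPoly α F₁ F₂)).eval x / (omegaPoly α F₁ F₂).eval x)
    + x * ((derivative (derivative (omegaPoly α F₁ F₂))).eval x / (omegaPoly α F₁ F₂).eval x)

/-- The differential operator `D_F = x ∂² + h₁ ∂ + h₀`. -/
def laguerreOperator (α : ℝ) (F₁ F₂ : Finset ℕ) (y : ℝ → ℝ) (x : ℝ) : ℝ :=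
  x * deriv (deriv y) x + coeffOne α F₁ F₂ x * deriv y x + coeffZero α F₁ F₂ x * y x

end

/-!
The rows indexed by `F₂` satisfy `L_f^{α+j}(-x) = e^{-x} (d/dx)^j (e^x L_f^α(-x))`, so up to a
factor `e^{k₂ x}` both determinants are Wronskians of eigenfunctions of the Laguerre operator
`T = x ∂² + (α + 1 - x) ∂`: the polynomials `L_f^α`, with eigenvalue `-f`, and the functions
`e^x L_f^α(-x)`, with eigenvalue `f + α + 1`.

Nonvanishing (`det_twistedJet_ne_zero`). The functions are linearly independent, since the
polynomials of each kind have distinct degrees and `e^x` is transcendental. If their Wronskian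
vanished, a nonzero differential operator with polynomial coefficients and order less than the
number of functions would annihilate all of them. At a point where its leading coefficient does not vanish,
the solution space of such an operator is too small.

Eigenvalue equation (`crum_transform`). Where the Wronskian `W` of `f₁, …, f_k` does not vanish, let
`A` be the monic operator of order `k` annihilating the `f_i`, so that `W(y, f) = ± W · A y`.
Comparing the two leading orders gives a second order operator `T'`, depending on `W` only through the
logarithmic derivative `w = W' / W`, for which `A T - T' A` has order less than `k`. This difference
annihilates every `f_i`, because each of them is an eigenfunction of `T`; hence it is zero, and `A`
carries eigenfunctions of `T` to eigenfunctions of `T'`. This argument does not need the eigenvalues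
to be distinct, which matters because `-f = f' + α + 1` can occur for negative integers `α`.
Conjugating `T'` by `Ω` gives the operator `D_F`.

The calculation takes place in the ring of formal power series, after expanding at a point where `Ω`
does not vanish: there `Ω` is a unit, and the exponential is available.
-/

/-! ### Wronskians in a commutative ring with a derivation -/

section Wronskian

variable {S R : Type*} [CommRing S] [CommRing R] [Algebra S R] (D : Derivation S R R)

/-- The Wronskian `det (D^j f_i)` of a finite family in a differential ring. -/
def wronskianDet {k : ℕ} (f : Fin k → R) : R :=
  Matrix.det (Matrix.of fun i j : Fin k => D^[(j : ℕ)] (f i))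

theorem derivation_prod {ι : Type*} [DecidableEq ι] (s : Finset ι) (g : ι → R) :
    D (∏ j ∈ s, g j) = ∑ l ∈ s, ∏ j ∈ s, Function.update g l (D (g l)) j := by
  induction s using Finset.induction_on with
  | empty => simp
  | insert a s ha ih =>
    rw [Finset.prod_insert ha, D.leibniz, ih, Finset.sum_insert ha, Finset.prod_insert ha,
      Function.update_self, add_comm]
    have h1 : ∏ j ∈ s, Function.update g a (D (g a)) j = ∏ j ∈ s, g j :=
      Finset.prod_congr rfl fun j hj =>
        Function.update_of_ne (fun h => ha (by rwa [← h])) _ _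
    have h2 : ∑ l ∈ s, ∏ j ∈ insert a s, Function.update g l (D (g l)) j
        = ∑ l ∈ s, g a * ∏ j ∈ s, Function.update g l (D (g l)) j :=
      Finset.sum_congr rfl fun l hl => by
        rw [Finset.prod_insert ha, Function.update_of_ne (fun h => ha (by rwa [h]))]
    rw [h1, h2, ← Finset.mul_sum, smul_eq_mul, smul_eq_mul, mul_comm (D (g a))]

/-- A derivation differentiates a determinant column by column. -/
theorem derivation_det {n : Type*} [Fintype n] [DecidableEq n] (M : Matrix n n R) :
    D M.det = ∑ l, (M.updateCol l fun i => D (M i l)).det := by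
  simp only [Matrix.det_apply, map_sum]
  rw [Finset.sum_comm]
  refine Finset.sum_congr rfl fun σ _ => ?_
  rw [Units.smul_def, map_zsmul, derivation_prod, Finset.smul_sum]
  refine Finset.sum_congr rfl fun l _ => ?_
  rw [Units.smul_def]
  congr 1
  refine Finset.prod_congr rfl fun j _ => ?_
  by_cases h : j = l
  · subst h; simp
  · simp [h]

/-- Only the differentiation of the last column contributes: in every other term two columns
coincide. -/
theorem derivation_wronskianDet {m : ℕ} (f : Fin (m + 1) → R) :
    D (wronskianDet D f) =
      ((Matrix.of fun i j : Fin (m + 1) => D^[(j : ℕ)] (f i)).updateCol (Fin.last m)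
        fun i => D^[m + 1] (f i)).det := by
  rw [wronskianDet, derivation_det, Finset.sum_eq_single (Fin.last m)]
  · simp [Function.iterate_succ_apply']
  · intro l _ hl
    obtain ⟨l, rfl⟩ := Fin.exists_castSucc_eq.2 hl
    refine Matrix.det_zero_of_column_eq (i := l.castSucc) (j := l.succ)
      (Fin.castSucc_lt_succ).ne fun i => ?_
    rw [Matrix.updateCol_self, Matrix.updateCol_ne (Fin.castSucc_lt_succ).ne']
    simp [Function.iterate_succ_apply']
  · simp

variable {D}

/-- Where the Wronskian is invertible there is a monic differential operator
`D^k + a_{k-1} D^{k-1} + ⋯ + a_0` annihilating the family. -/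
theorem exists_annihilator {k : ℕ} {f : Fin k → R} (hW : IsUnit (wronskianDet D f)) :
    ∃ a : ℕ → R, a k = 1 ∧ ∀ i, ∑ j ∈ Finset.range (k + 1), a j * D^[j] (f i) = 0 := by
  set M : Matrix (Fin k) (Fin k) R := Matrix.of fun i j : Fin k => D^[(j : ℕ)] (f i) with hM
  set v : Fin k → R := M⁻¹.mulVec fun i => -D^[k] (f i) with hv
  refine ⟨fun j => if h : j < k then v ⟨j, h⟩ else 1, by simp, fun i => ?_⟩
  have h1 : M.mulVec v = fun i => -D^[k] (f i) := by
    rw [hv, Matrix.mulVec_mulVec, Matrix.mul_nonsing_inv _ hW, Matrix.one_mulVec]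
  have h2 := congrFun h1 i
  rw [Finset.sum_range_succ, Finset.sum_range]
  simp only [Matrix.mulVec, dotProduct, hM, Matrix.of_apply] at h2
  simp only [Fin.is_lt, dite_true, Fin.eta, lt_irrefl, dite_false, one_mul]
  rw [add_eq_zero_iff_eq_neg, ← h2]
  simp [mul_comm]

/-- An operator of order less than `k` annihilating `k` elements with invertible Wronskian is
zero. -/
theorem annihilator_eq_zero {k : ℕ} {f : Fin k → R} (hW : IsUnit (wronskianDet D f))
    {b : ℕ → R} (hb : ∀ i, ∑ j ∈ Finset.range k, b j * D^[j] (f i) = 0) :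
    ∀ j < k, b j = 0 := by
  have h1 : (Matrix.of fun i j : Fin k => D^[(j : ℕ)] (f i)).mulVec (fun j => b j) = 0 := by
    ext i
    rw [Pi.zero_apply, ← hb i, Finset.sum_range]
    simp [Matrix.mulVec, dotProduct, mul_comm]
  have h2 := congrArg (Matrix.mulVec (Matrix.of fun i j : Fin k => D^[(j : ℕ)] (f i))⁻¹) h1
  rw [Matrix.mulVec_mulVec, Matrix.nonsing_inv_mul _ hW, Matrix.one_mulVec,
    Matrix.mulVec_zero] at h2
  exact fun j hj => congrFun h2 ⟨j, hj⟩

/-- Abel's formula. -/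
theorem derivation_wronskianDet_eq {m : ℕ} {f : Fin (m + 1) → R} {a : ℕ → R}
    (ha : a (m + 1) = 1) (hf : ∀ i, ∑ j ∈ Finset.range (m + 2), a j * D^[j] (f i) = 0) :
    D (wronskianDet D f) = -a m * wronskianDet D f := by
  rw [derivation_wronskianDet]
  have h := Matrix.det_updateCol_sum (Matrix.of fun i j : Fin (m + 1) => D^[(j : ℕ)] (f i))
    (Fin.last m) (fun j => -a j)
  rw [smul_eq_mul, Fin.val_last] at h
  rw [wronskianDet, ← h]
  congr 2
  ext i
  have := hf i
  rw [Finset.sum_range_succ, ha, one_mul, Finset.sum_range] at this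
  simp only [Matrix.of_apply, smul_eq_mul, neg_mul, Finset.sum_neg_distrib]
  linear_combination this

/-- Bordering the Wronskian by `y` amounts to applying the annihilating operator to `y`. -/
theorem wronskianDet_cons {k : ℕ} {f : Fin k → R} {a : ℕ → R}
    (ha : a k = 1) (hf : ∀ i, ∑ j ∈ Finset.range (k + 1), a j * D^[j] (f i) = 0) (y : R) :
    wronskianDet D (Fin.cons y f : Fin (k + 1) → R) =
      (-1) ^ k * wronskianDet D f * ∑ j ∈ Finset.range (k + 1), a j * D^[j] y := by
  set M : Matrix (Fin (k + 1)) (Fin (k + 1)) R :=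
    Matrix.of fun i j => D^[(j : ℕ)] ((Fin.cons y f : Fin (k + 1) → R) i) with hM
  have h := Matrix.det_updateCol_sum M (Fin.last k) (fun j => a j)
  rw [smul_eq_mul, Fin.val_last, ha, one_mul] at h
  change M.det = _
  -- after this column operation the last column is `(A y, 0, …, 0)`
  rw [← h, Matrix.det_succ_column _ (Fin.last k), Fin.sum_univ_succ, Finset.sum_eq_zero]
  · have hs : (M.updateCol (Fin.last k) fun r => ∑ i : Fin (k + 1), a i • M r i).submatrix
        (Fin.succAbove 0) (Fin.last k).succAbove
        = Matrix.of fun i j : Fin k => D^[(j : ℕ)] (f i) := by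
      ext i j
      simp [hM, Fin.succAbove_last]
    rw [hs, Matrix.updateCol_self, Finset.sum_range, wronskianDet]
    simp [hM]
    ring
  · intro i _
    rw [Matrix.updateCol_self]
    have := hf i
    rw [Finset.sum_range] at this
    simp [hM, this]

/-- The Leibniz rule for a factor with vanishing second derivative, stated for a multiple of a
derivative so that no index is lowered. -/
theorem iterate_derivation_mul_derivation {p : R} (hp : D (D p) = 0) (y : R) (j : ℕ) :
    D^[j] (p * D y) = p * D^[j + 1] y + j * D p * D^[j] y := by
  induction j with
  | zero => simp
  | succ j ih =>
    rw [Function.iterate_succ_apply', ih, map_add, D.leibniz, D.leibniz, D.leibniz,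
      Function.iterate_succ_apply' D (j + 1), Function.iterate_succ_apply' D j]
    simp only [hp, smul_eq_mul, Derivation.map_natCast]
    push_cast
    ring

theorem iterate_derivation_mul_const {c : R} (hc : D c = 0) (y : R) (j : ℕ) :
    D^[j] (c * y) = c * D^[j] y := by
  induction j with
  | zero => rfl
  | succ j ih => rw [Function.iterate_succ_apply', ih, D.leibniz, hc, smul_zero, add_zero,
      smul_eq_mul, Function.iterate_succ_apply']

/-- The commutation defect `A T - T' A` of an operator `A = ∑_{j ≤ m+1} a_j D^j` with `a_{m+1} = 1`
has order at most `m`, when `T = p D² + q D` with `p`, `q` of degree at most one and `T'` is the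
transformed operator whose coefficients are dictated by the two leading orders. -/
theorem exists_intertwining_defect {p q : R} (hp : D (D p) = 0) (hq : D (D q) = 0) {m : ℕ}
    {a : ℕ → R} (ha : a (m + 1) = 1) :
    ∃ b : ℕ → R, ∀ y : R,
      (∑ j ∈ Finset.range (m + 2), a j * D^[j] (p * D (D y) + q * D y))
        - (p * D (D (∑ j ∈ Finset.range (m + 2), a j * D^[j] y))
          + (q + (m + 1 : ℕ) * D p) * D (∑ j ∈ Finset.range (m + 2), a j * D^[j] y)
          + ((m + 1 : ℕ) * D q - a m * D p - 2 * p * D (a m))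
            * ∑ j ∈ Finset.range (m + 2), a j * D^[j] y)
      = ∑ j ∈ Finset.range (m + 1), b j * D^[j] y := by
  -- `g j` and `h j` are the coefficients of `D^{j+1}` and `D^j` contributed by the term `a_j D^j`
  set Q : R := q + (m + 1 : ℕ) * D p with hQ
  set r : R := (m + 1 : ℕ) * D q - a m * D p - 2 * p * D (a m) with hr
  set g : ℕ → R := fun j => a j * (j * D p + q - Q) - 2 * p * D (a j) with hg
  set h : ℕ → R := fun j => j * D q * a j - p * D (D (a j)) - Q * D (a j) - r * a j with hh
  refine ⟨fun j => (if j = 0 then 0 else g (j - 1)) + h j, fun y => ?_⟩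
  have hterm : ∀ j, a j * D^[j] (p * D (D y) + q * D y)
      - (p * D (D (a j * D^[j] y)) + Q * D (a j * D^[j] y) + r * (a j * D^[j] y))
      = g j * D^[j + 1] y + h j * D^[j] y := by
    intro j
    have h1 : D^[j] (p * D (D y) + q * D y) = D^[j] (p * D (D y)) + D^[j] (q * D y) :=
      iterate_map_add D j _ _
    rw [h1, iterate_derivation_mul_derivation hp, iterate_derivation_mul_derivation hq,
      ← Function.iterate_succ_apply D (j + 1), ← Function.iterate_succ_apply D j]
    simp only [D.leibniz, map_add, smul_eq_mul, ← Function.iterate_succ_apply' D, hg, hh]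
    ring
  have htop : g (m + 1) = 0 := by
    simp only [hg, ha, hQ, D.map_one_eq_zero]
    ring
  have hnext : g m + h (m + 1) = 0 := by
    simp only [hg, hh, ha, hQ, hr, D.map_one_eq_zero, map_zero]
    push_cast
    ring
  have hsum : (∑ j ∈ Finset.range (m + 2), a j * D^[j] (p * D (D y) + q * D y))
        - (p * D (D (∑ j ∈ Finset.range (m + 2), a j * D^[j] y))
          + Q * D (∑ j ∈ Finset.range (m + 2), a j * D^[j] y)
          + r * ∑ j ∈ Finset.range (m + 2), a j * D^[j] y)
      = ∑ j ∈ Finset.range (m + 2), (g j * D^[j + 1] y + h j * D^[j] y) := by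
    simp only [map_sum, Finset.mul_sum, ← Finset.sum_add_distrib, ← Finset.sum_sub_distrib]
    exact Finset.sum_congr rfl fun j _ => hterm j
  rw [hsum, Finset.sum_add_distrib, Finset.sum_range_succ _ (m + 1), htop,
    Finset.sum_range_succ _ m, Finset.sum_range_succ (fun j => h j * D^[j] y) (m + 1)]
  simp only [add_mul, Finset.sum_add_distrib]
  rw [Finset.sum_range_succ' (fun j => (if j = 0 then 0 else g (j - 1)) * D^[j] y) m]
  simp only [Nat.add_eq_zero_iff, one_ne_zero, and_false, if_false, if_true, zero_mul, add_zero,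
    Nat.add_sub_cancel]
  linear_combination D^[m + 1] y * hnext

/-- Crum's theorem: if `f_1, …, f_k` are eigenvectors of `T = p D² + q D` with invertible
Wronskian `W`, the monic order `k` operator annihilating them carries eigenvectors of `T` to
eigenvectors of a second order operator in which only `w = W' / W` enters. No distinctness of the
eigenvalues is needed: the commutation defect has order less than `k` and annihilates every `f_i`,
hence vanishes. -/
theorem crum_transform {p q w : R} (hp : D (D p) = 0) (hq : D (D q) = 0) {k : ℕ}
    {f : Fin k → R} (hW : IsUnit (wronskianDet D f))
    (hw : D (wronskianDet D f) = w * wronskianDet D f)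
    {c : Fin k → R} (hc : ∀ i, D (c i) = 0)
    (hf : ∀ i, p * D (D (f i)) + q * D (f i) = c i * f i)
    {a : ℕ → R} (ha : a k = 1)
    (hann : ∀ i, ∑ j ∈ Finset.range (k + 1), a j * D^[j] (f i) = 0)
    {y μ : R} (hμ : D μ = 0) (hy : p * D (D y) + q * D y = μ * y) :
    p * D (D (∑ j ∈ Finset.range (k + 1), a j * D^[j] y))
      + (q + k * D p) * D (∑ j ∈ Finset.range (k + 1), a j * D^[j] y)
      + (k * D q + w * D p + 2 * p * D w) * ∑ j ∈ Finset.range (k + 1), a j * D^[j] y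
      = μ * ∑ j ∈ Finset.range (k + 1), a j * D^[j] y := by
  have hconst : ∀ ν z : R, D ν = 0 → ∑ j ∈ Finset.range (k + 1), a j * D^[j] (ν * z)
      = ν * ∑ j ∈ Finset.range (k + 1), a j * D^[j] z := by
    intro ν z hν
    rw [Finset.mul_sum]
    refine Finset.sum_congr rfl fun j _ => ?_
    rw [iterate_derivation_mul_const hν]
    ring
  cases k with
  | zero =>
    have hw0 : w = 0 := by
      have h1 : wronskianDet D f = 1 := Matrix.det_isEmpty
      rw [h1, D.map_one_eq_zero, mul_one] at hw
      exact hw.symm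
    simpa [ha, hw0] using hy
  | succ m =>
    have hwa : w = -a m := by
      have h1 := derivation_wronskianDet_eq ha hann
      rw [hw] at h1
      exact hW.mul_right_cancel h1
    obtain ⟨b, hb⟩ := exists_intertwining_defect hp hq ha
    have hb0 : ∀ j < m + 1, b j = 0 := by
      refine annihilator_eq_zero hW fun i => ?_
      rw [← hb (f i), hf i, hconst _ _ (hc i), hann i]
      simp
    have h2 := hb y
    have h3 : ∑ j ∈ Finset.range (m + 1), b j * D^[j] y = 0 :=
      Finset.sum_eq_zero fun j hj => by rw [hb0 j (Finset.mem_range.1 hj), zero_mul]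
    rw [h3, hy, hconst _ _ hμ] at h2
    rw [hwa, map_neg]
    linear_combination -h2

end Wronskian

/-! ### Laguerre polynomials -/

theorem coeff_laguerrePoly (α : ℝ) (n j : ℕ) :
    (laguerrePoly α n).coeff j =
      if j ≤ n then (-1) ^ j * (Ring.choose ((n : ℝ) + α) (n - j) / (j.factorial : ℝ)) else 0 := by
  have h : ∀ i : ℕ, (C (Ring.choose ((n : ℝ) + α) (n - i) / (i.factorial : ℝ)) * (-X) ^ i : ℝ[X])
      = C ((-1) ^ i * (Ring.choose ((n : ℝ) + α) (n - i) / (i.factorial : ℝ))) * X ^ i := by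
    intro i
    rw [neg_pow, C_mul, C_pow, C_neg, C_1]
    ring
  simp only [laguerrePoly, h, finsetSum_coeff, coeff_C_mul_X_pow]
  rw [Finset.sum_ite_eq]
  simp

theorem natDegree_laguerrePoly (α : ℝ) (n : ℕ) : (laguerrePoly α n).natDegree = n := by
  refine natDegree_eq_of_le_of_coeff_ne_zero ?_ ?_
  · refine natDegree_le_iff_coeff_eq_zero.2 fun j hj => ?_
    rw [coeff_laguerrePoly, if_neg (by omega)]
  · rw [coeff_laguerrePoly, if_pos le_rfl, Nat.sub_self, Ring.choose_zero_right]
    positivity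

theorem laguerrePoly_ne_zero (α : ℝ) (n : ℕ) : laguerrePoly α n ≠ 0 := by
  intro h
  have h1 := coeff_laguerrePoly α n n
  rw [h, if_pos le_rfl, Nat.sub_self, Ring.choose_zero_right, coeff_zero] at h1
  have h2 : (-1 : ℝ) ^ n * (1 / (n.factorial : ℝ)) ≠ 0 := by positivity
  exact h2 h1.symm

theorem ringChoose_succ_mul (z : ℝ) (m : ℕ) :
    (m + 1) * Ring.choose z (m + 1) = (z - m) * Ring.choose z m := by
  have h1 := Ring.descPochhammer_eq_factorial_smul_choose z (m + 1)
  rw [descPochhammer_succ_right, smeval_mul, Ring.descPochhammer_eq_factorial_smul_choose,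
    smeval_sub, smeval_X, pow_one, smeval_natCast, pow_zero, nsmul_eq_mul, nsmul_eq_mul,
    nsmul_eq_mul, Nat.factorial_succ, mul_one] at h1
  have h2 : (m.factorial : ℝ) ≠ 0 := by positivity
  push_cast at h1
  refine mul_left_cancel₀ h2 ?_
  linear_combination -h1

/-- Contiguity: `L_n^{α+1} = L_n^α - (L_n^α)'`. -/
theorem laguerrePoly_add_one (α : ℝ) (n : ℕ) :
    laguerrePoly (α + 1) n = laguerrePoly α n - derivative (laguerrePoly α n) := by
  ext j
  rw [coeff_sub, coeff_derivative, coeff_laguerrePoly, coeff_laguerrePoly, coeff_laguerrePoly]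
  rcases lt_trichotomy j n with h | rfl | h
  · obtain ⟨m, rfl⟩ := Nat.exists_eq_add_of_lt h
    rw [if_pos h.le, if_pos h.le, if_pos (by omega), show j + m + 1 - j = m + 1 by omega,
      show j + m + 1 - (j + 1) = m by omega, ← add_assoc, Ring.choose_succ_succ,
      Nat.factorial_succ]
    have : (j.factorial : ℝ) ≠ 0 := by positivity
    push_cast
    field_simp
    ring
  · simp
  · simp [h.not_ge, (show ¬ j + 1 ≤ n by omega)]

/-- Laguerre's differential equation, for arbitrary real parameter. -/
theorem laguerrePoly_ode (α : ℝ) (n : ℕ) :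
    X * derivative (derivative (laguerrePoly α n))
      + (C (α + 1) - X) * derivative (laguerrePoly α n) = C (-(n : ℝ)) * laguerrePoly α n := by
  -- the equation is equivalent to this recurrence for the coefficients
  have key : ∀ j : ℕ, ((j : ℝ) + 1) * (j + 1 + α) * (laguerrePoly α n).coeff (j + 1)
      = (j - n) * (laguerrePoly α n).coeff j := by
    intro j
    rw [coeff_laguerrePoly, coeff_laguerrePoly]
    rcases lt_trichotomy j n with h | rfl | h
    · obtain ⟨m, rfl⟩ := Nat.exists_eq_add_of_lt h
      rw [if_pos h.le, if_pos (by omega), show j + m + 1 - j = m + 1 by omega,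
        show j + m + 1 - (j + 1) = m by omega, Nat.factorial_succ]
      have : (j.factorial : ℝ) ≠ 0 := by positivity
      have hc := ringChoose_succ_mul (((j + m + 1 : ℕ) : ℝ) + α) m
      push_cast at hc ⊢
      field_simp
      linear_combination (-1) ^ j * hc
    · simp
    · simp [h.not_ge, (show ¬ j + 1 ≤ n by omega)]
  ext j
  rw [sub_mul, coeff_add, coeff_sub, coeff_C_mul, coeff_C_mul]
  cases j with
  | zero =>
    have := key 0
    simp only [coeff_X_mul_zero, coeff_derivative] at this ⊢
    push_cast at this ⊢
    linear_combination this
  | succ j =>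
    have := key (j + 1)
    simp only [coeff_X_mul, coeff_derivative] at this ⊢
    push_cast at this ⊢
    linear_combination this

theorem derivative_comp_neg_X (p : ℝ[X]) :
    derivative (p.comp (-X)) = -(derivative p).comp (-X) := by
  rw [derivative_comp]; simp

/-! ### Expansion of polynomials and exponentials at a point -/

/-- The Taylor expansion of a polynomial at `x₀`, as a formal power series. -/
noncomputable def taylorSeries (x₀ : ℝ) : ℝ[X] →ₐ[ℝ] PowerSeries ℝ :=
  (Polynomial.coeToPowerSeries.algHom ℝ).comp (taylorAlgHom x₀)

theorem taylorSeries_apply (x₀ : ℝ) (p : ℝ[X]) :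
    taylorSeries x₀ p = ((taylor x₀ p : ℝ[X]) : PowerSeries ℝ) := by
  simp [taylorSeries, Polynomial.coeToPowerSeries.algHom_apply]

theorem taylorSeries_injective (x₀ : ℝ) : Function.Injective (taylorSeries x₀) := by
  intro p q h
  rw [taylorSeries_apply, taylorSeries_apply] at h
  exact taylor_injective x₀ (Polynomial.coe_injective ℝ h)

theorem constantCoeff_taylorSeries (x₀ : ℝ) (p : ℝ[X]) :
    PowerSeries.constantCoeff (taylorSeries x₀ p) = p.eval x₀ := by
  rw [taylorSeries_apply, ← PowerSeries.coeff_zero_eq_constantCoeff_apply, Polynomial.coeff_coe,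
    taylor_coeff_zero]

theorem derivative_taylorSeries (x₀ : ℝ) (p : ℝ[X]) :
    PowerSeries.derivative ℝ (taylorSeries x₀ p) = taylorSeries x₀ (derivative p) := by
  rw [taylorSeries_apply, taylorSeries_apply, PowerSeries.derivative_coe, taylor_apply,
    taylor_apply, derivative_comp]
  simp

/-- The weight of a row: `exp` for `true`, and `1` for `false`. -/
noncomputable def expWeight (b : Bool) : PowerSeries ℝ := if b then PowerSeries.exp ℝ else 1

/-- The polynomials `(d/dx + b)^j p`, where `b ∈ {0, 1}`: the `j`-th derivative of `e^{bx} p`, with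
the exponential divided out. The value `b` is encoded as a Boolean. -/
noncomputable def twistedJet (b : Bool) (p : ℝ[X]) (j : ℕ) : ℝ[X] :=
  (fun q => derivative q + if b then q else 0)^[j] p

theorem isUnit_expWeight (b : Bool) : IsUnit (expWeight b) := by
  cases b
  · simp [expWeight]
  · simpa [expWeight] using PowerSeries.isUnit_exp ℝ

theorem derivative_expWeight_mul (b : Bool) (x₀ : ℝ) (p : ℝ[X]) :
    PowerSeries.derivative ℝ (expWeight b * taylorSeries x₀ p)
      = expWeight b * taylorSeries x₀ (derivative p + if b then p else 0) := by
  rw [Derivation.leibniz, derivative_taylorSeries]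
  cases b
  · simp [expWeight]
  · simp [expWeight, PowerSeries.derivative_exp]
    ring

theorem iterate_derivative_expWeight_mul (b : Bool) (x₀ : ℝ) (p : ℝ[X]) (j : ℕ) :
    (PowerSeries.derivative ℝ)^[j] (expWeight b * taylorSeries x₀ p)
      = expWeight b * taylorSeries x₀ (twistedJet b p j) := by
  induction j with
  | zero => rfl
  | succ j ih =>
    rw [Function.iterate_succ_apply', ih, derivative_expWeight_mul, twistedJet, twistedJet,
      Function.iterate_succ_apply']

theorem twistedJet_true_eq_zero {p : ℝ[X]} {j : ℕ} (h : twistedJet true p j = 0) : p = 0 := by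
  induction j with
  | zero => exact h
  | succ j ih =>
    refine ih ?_
    rw [twistedJet, Function.iterate_succ_apply', ← twistedJet] at h
    by_contra hq
    have h1 := degree_derivative_lt hq
    rw [if_pos rfl] at h
    rw [eq_neg_of_add_eq_zero_left h, degree_neg] at h1
    exact lt_irrefl _ h1

theorem twistedJet_false (p : ℝ[X]) (j : ℕ) : twistedJet false p j = derivative^[j] p := by
  simp [twistedJet]

/-- Polynomials and polynomial multiples of `exp` are linearly disjoint. -/
theorem eq_zero_of_add_exp_mul_eq_zero {x₀ : ℝ} {P Q : ℝ[X]}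
    (h : taylorSeries x₀ P + PowerSeries.exp ℝ * taylorSeries x₀ Q = 0) : P = 0 ∧ Q = 0 := by
  have h0 : expWeight false * taylorSeries x₀ P + expWeight true * taylorSeries x₀ Q = 0 := by
    simpa [expWeight] using h
  -- enough derivatives kill the polynomial part
  have h1 := congrArg (PowerSeries.derivative ℝ)^[P.natDegree + 1] h0
  rw [iterate_map_add, iterate_derivative_expWeight_mul, iterate_derivative_expWeight_mul,
    iterate_map_zero, twistedJet_false, iterate_derivative_eq_zero (Nat.lt_succ_self _), map_zero,
    mul_zero, zero_add, (isUnit_expWeight true).mul_right_eq_zero,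
    map_eq_zero_iff _ (taylorSeries_injective x₀)] at h1
  have hQ := twistedJet_true_eq_zero h1
  refine ⟨?_, hQ⟩
  rwa [hQ, map_zero, mul_zero, add_zero, map_eq_zero_iff _ (taylorSeries_injective x₀)] at h

theorem eq_zero_of_sum_smul_eq_zero_of_natDegree_injOn {ι : Type*} {s : Finset ι} {p : ι → ℝ[X]}
    (hp : ∀ i ∈ s, p i ≠ 0) (hinj : Set.InjOn (fun i => (p i).natDegree) s) {g : ι → ℝ}
    (h : ∑ i ∈ s, g i • p i = 0) : ∀ i ∈ s, g i = 0 := by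
  by_contra! hne
  obtain ⟨i₁, hi₁, hg₁⟩ := hne
  obtain ⟨i₀, hi₀, hmax⟩ := (s.filter fun i => g i ≠ 0).exists_max_image
    (fun i => (p i).natDegree) ⟨i₁, Finset.mem_filter.2 ⟨hi₁, hg₁⟩⟩
  obtain ⟨hi₀, hg₀⟩ := Finset.mem_filter.1 hi₀
  have h1 := congrArg (fun q => q.coeff (p i₀).natDegree) h
  simp only [finsetSum_coeff, coeff_smul, smul_eq_mul, coeff_zero] at h1
  rw [Finset.sum_eq_single_of_mem i₀ hi₀] at h1
  · exact mul_ne_zero hg₀ (leadingCoeff_ne_zero.2 (hp i₀ hi₀)) h1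
  · intro i hi hne
    by_cases hg : g i = 0
    · rw [hg, zero_mul]
    · rw [coeff_eq_zero_of_natDegree_lt, mul_zero]
      exact lt_of_le_of_ne (hmax i (Finset.mem_filter.2 ⟨hi, hg⟩))
        fun h => hne (hinj hi hi₀ h)

theorem linearIndependent_expWeight_mul {ι : Type*} [Fintype ι] {b : ι → Bool} {p : ι → ℝ[X]}
    (hp : ∀ i, p i ≠ 0) (hinj : Function.Injective fun i => (b i, (p i).natDegree)) (x₀ : ℝ) :
    LinearIndependent ℝ fun i => expWeight (b i) * taylorSeries x₀ (p i) := by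
  rw [Fintype.linearIndependent_iff]
  intro g hg
  have h1 : taylorSeries x₀ (∑ i with b i = false, g i • p i)
      + PowerSeries.exp ℝ * taylorSeries x₀ (∑ i with b i = true, g i • p i) = 0 := by
    rw [← hg, ← Finset.sum_filter_add_sum_filter_not Finset.univ (fun i => b i = false)]
    simp only [Bool.not_eq_false, map_sum, map_smul, Finset.mul_sum]
    congr 1
    · refine Finset.sum_congr rfl fun i hi => ?_
      simp [(Finset.mem_filter.1 hi).2, expWeight]
    · refine Finset.sum_congr rfl fun i hi => ?_
      simp [(Finset.mem_filter.1 hi).2, expWeight]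
  obtain ⟨hP, hQ⟩ := eq_zero_of_add_exp_mul_eq_zero h1
  have h2 : ∀ c : Bool, ∑ i with b i = c, g i • p i = 0 → ∀ i, b i = c → g i = 0 := by
    intro c hc i hi
    refine eq_zero_of_sum_smul_eq_zero_of_natDegree_injOn (fun i _ => hp i) ?_ hc i (by simp [hi])
    intro i hi j hj hij
    simp only [Finset.coe_filter, Finset.mem_univ, true_and, Set.mem_ofPred_eq] at hi hj
    exact hinj (Prod.ext (hi.trans hj.symm) hij)
  intro i
  cases hi : b i
  · exact h2 false hP i hi
  · exact h2 true hQ i hi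

/-! ### Nonvanishing of the determinants -/

/-- At a point where its leading coefficient does not vanish, a linear differential equation of
order `r` has no nonzero solution with zero initial data. -/
theorem eq_zero_of_linear_ode {r : ℕ} {c : ℕ → PowerSeries ℝ} {f : PowerSeries ℝ}
    (hc : PowerSeries.constantCoeff (c r) ≠ 0)
    (hf : ∑ j ∈ Finset.range (r + 1), c j * (PowerSeries.derivative ℝ)^[j] f = 0)
    (h0 : ∀ m < r, PowerSeries.coeff m f = 0) : f = 0 := by
  ext n
  rw [map_zero]
  induction n using Nat.strong_induction_on with
  | _ n ih =>
    rcases lt_or_ge n r with hn | hn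
    · exact h0 n hn
    -- the coefficient of `X^m` in the equation determines the coefficient of `X^(m + r)` in `f`
    obtain ⟨m, rfl⟩ := Nat.exists_eq_add_of_le' hn
    have h1 := congrArg (PowerSeries.coeff m) hf
    rw [map_sum, map_zero, Finset.sum_range_succ, Finset.sum_eq_zero, zero_add,
      PowerSeries.coeff_mul, Finset.sum_eq_single_of_mem (0, m) (by simp)] at h1
    · rw [PowerSeries.coeff_iterate_derivative, PowerSeries.coeff_zero_eq_constantCoeff_apply] at h1
      have h2 : (((m + 1).ascFactorial r : ℕ) : ℝ) ≠ 0 := by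
        exact_mod_cast (Nat.ascFactorial_pos _ _).ne'
      simpa [hc, h2] using h1
    · rintro ⟨u, v⟩ huv hne
      rw [Finset.HasAntidiagonal.mem_antidiagonal] at huv
      have hv : v < m := by
        rcases Nat.eq_zero_or_pos u with rfl | hu
        · simp_all
        · simp only at huv; omega
      rw [PowerSeries.coeff_iterate_derivative, ih _ (by simp only; omega)]
      simp
    · intro j hj
      rw [PowerSeries.coeff_mul]
      refine Finset.sum_eq_zero fun uv huv => ?_
      rw [Finset.HasAntidiagonal.mem_antidiagonal] at huv
      have hj' := Finset.mem_range.1 hj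
      rw [PowerSeries.coeff_iterate_derivative, ih _ (by omega)]
      simp

/-- A vanishing determinant would give a differential operator of order `r < k` with polynomial
coefficients annihilating `k` linearly independent functions. At a point where its leading
coefficient does not vanish, some nontrivial combination of them has zero initial data up to order
`r`, hence is zero. -/
theorem det_twistedJet_ne_zero {k : ℕ} {b : Fin k → Bool} {p : Fin k → ℝ[X]}
    (hp : ∀ i, p i ≠ 0) (hinj : Function.Injective fun i => (b i, (p i).natDegree)) :
    Matrix.det (Matrix.of fun i j : Fin k => twistedJet (b i) (p i) j) ≠ 0 := by
  intro hdet
  obtain ⟨v, hv0, hv⟩ := Matrix.exists_mulVec_eq_zero_iff.2 hdet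
  obtain ⟨r, hr, hmax⟩ : ∃ r : Fin k, v r ≠ 0 ∧ ∀ j, r < j → v j = 0 := by
    obtain ⟨i, hi⟩ := Function.ne_iff.1 hv0
    obtain ⟨r, hr, hm⟩ := (Finset.univ.filter fun i => v i ≠ 0).exists_max_image id
      ⟨i, by simpa using hi⟩
    refine ⟨r, (Finset.mem_filter.1 hr).2, fun j hj => ?_⟩
    by_contra hne
    exact absurd (hm j (by simpa using hne)) (not_le.2 hj)
  obtain ⟨x₀, hx₀⟩ : ∃ x₀, (v r).eval x₀ ≠ 0 := by
    by_contra! h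
    exact hr (Polynomial.funext fun x => by rw [h x, eval_zero])
  set f : Fin k → PowerSeries ℝ := fun i => expWeight (b i) * taylorSeries x₀ (p i) with hf
  have hli : LinearIndependent ℝ f := linearIndependent_expWeight_mul hp hinj x₀
  set c : ℕ → PowerSeries ℝ := fun j => if h : j < k then taylorSeries x₀ (v ⟨j, h⟩) else 0 with hc
  have hode : ∀ i, ∑ j ∈ Finset.range ((r : ℕ) + 1), c j * (PowerSeries.derivative ℝ)^[j] (f i)
      = 0 := by
    intro i
    have h1 : ∑ j ∈ Finset.range ((r : ℕ) + 1), c j * (PowerSeries.derivative ℝ)^[j] (f i)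
        = ∑ j ∈ Finset.range k, c j * (PowerSeries.derivative ℝ)^[j] (f i) := by
      refine Finset.sum_subset (Finset.range_subset_range.2 r.is_lt) fun j hj hj' => ?_
      rw [Finset.mem_range] at hj hj'
      simp only [hc, hj, dite_true]
      rw [hmax ⟨j, hj⟩ (Fin.lt_def.2 (by simp only; omega)), map_zero, zero_mul]
    have h2 := congrArg (fun q => expWeight (b i) * taylorSeries x₀ q) (congrFun hv i)
    simp only [Matrix.mulVec, dotProduct, Matrix.of_apply, map_sum, map_mul, Pi.zero_apply,
      map_zero, mul_zero, Finset.mul_sum] at h2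
    rw [h1, Finset.sum_range, ← h2]
    refine Finset.sum_congr rfl fun j _ => ?_
    rw [hf, iterate_derivative_expWeight_mul]
    simp only [hc, Fin.is_lt, dite_true, Fin.eta]
    ring
  let N : (Fin k → ℝ) →ₗ[ℝ] (Fin r → ℝ) :=
    LinearMap.pi fun m => (PowerSeries.coeff (R := ℝ) (m : ℕ)) ∘ₗ (Fintype.linearCombination ℝ f)
  have hker : LinearMap.ker N ≠ ⊥ := N.ker_ne_bot_of_finrank_lt (by simp)
  obtain ⟨g, hg, hg0⟩ := Submodule.exists_mem_ne_zero_of_ne_bot hker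
  refine hg0 (funext (Fintype.linearIndependent_iff.1 hli g ?_))
  refine eq_zero_of_linear_ode (r := r) (c := c) ?_ ?_ ?_
  · simpa [hc, constantCoeff_taylorSeries] using hx₀
  · have h1 : ∀ j, (PowerSeries.derivative ℝ)^[j] (∑ i, g i • f i)
        = ∑ i, g i • (PowerSeries.derivative ℝ)^[j] (f i) := by
      intro j
      induction j with
      | zero => rfl
      | succ j ih => simp only [Function.iterate_succ_apply', ih, map_sum, Derivation.map_smul]
    simp only [h1, Finset.mul_sum, mul_smul_comm]
    rw [Finset.sum_comm]
    refine Finset.sum_eq_zero fun i _ => ?_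
    rw [← Finset.smul_sum, hode i, smul_zero]
  · intro m hm
    have h1 := congrFun (LinearMap.mem_ker.1 hg) ⟨m, hm⟩
    simpa [N, Fintype.linearCombination_apply] using h1

/-! ### The rows of the determinants -/

/-- The weights of the rows of `pairRows`: `1` for `F₁` and `exp` for `F₂`. -/
def pairFlag (F₁ F₂ : Finset ℕ) : Fin (F₁.card + F₂.card) → Bool :=
  Fin.append (fun _ => false) (fun _ => true)

/-- The polynomials in column `0` of `pairRows`. -/
noncomputable def pairSeed (α : ℝ) (F₁ F₂ : Finset ℕ) : Fin (F₁.card + F₂.card) → ℝ[X] :=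
  Fin.append (fun i => laguerrePoly α (F₁.orderEmbOfFin rfl i))
    (fun i => (laguerrePoly α (F₂.orderEmbOfFin rfl i)).comp (-X))

/-- This is `(d/dx)^j (e^x L_n^α(-x)) = e^x L_n^{α+j}(-x)`. -/
theorem twistedJet_laguerrePoly_comp (α : ℝ) (n j : ℕ) :
    twistedJet true ((laguerrePoly α n).comp (-X)) j
      = (laguerrePoly (α + j) n).comp (-X) := by
  induction j with
  | zero => simp [twistedJet]
  | succ j ih =>
    rw [twistedJet, Function.iterate_succ_apply', ← twistedJet, ih, if_pos rfl,
      derivative_comp_neg_X, Nat.cast_succ, ← add_assoc, laguerrePoly_add_one, sub_comp]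
    ring

theorem pairRows_eq_twistedJet (α : ℝ) (F₁ F₂ : Finset ℕ) (i : Fin (F₁.card + F₂.card)) (j : ℕ) :
    pairRows α F₁ F₂ i j = twistedJet (pairFlag F₁ F₂ i) (pairSeed α F₁ F₂ i) j := by
  induction i using Fin.addCases with
  | left i => simp [pairRows, pairFlag, pairSeed, twistedJet_false]
  | right i => simp [pairRows, pairFlag, pairSeed, twistedJet_laguerrePoly_comp]

theorem omegaPoly_eq_det_twistedJet (α : ℝ) (F₁ F₂ : Finset ℕ) :
    omegaPoly α F₁ F₂ = Matrix.det (Matrix.of fun i j : Fin (F₁.card + F₂.card) =>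
      twistedJet (pairFlag F₁ F₂ i) (pairSeed α F₁ F₂ i) j) := by
  simp only [omegaPoly, pairRows_eq_twistedJet]

theorem exceptionalLaguerre_eq_det_twistedJet (α : ℝ) (F₁ F₂ : Finset ℕ) (n : ℕ) :
    exceptionalLaguerre α F₁ F₂ n =
      Matrix.det (Matrix.of fun i j : Fin (F₁.card + F₂.card + 1) =>
        twistedJet ((Fin.cons false (pairFlag F₁ F₂) : Fin (F₁.card + F₂.card + 1) → Bool) i)
          ((Fin.cons (laguerrePoly α (n - uIndex F₁ F₂)) (pairSeed α F₁ F₂) :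
            Fin (F₁.card + F₂.card + 1) → ℝ[X]) i) j) := by
  rw [exceptionalLaguerre]
  congr 2
  ext1 i
  ext1 j
  induction i using Fin.cases with
  | zero => simp [twistedJet_false]
  | succ i => simp [pairRows_eq_twistedJet]

theorem natDegree_comp_neg_X (p : ℝ[X]) : (p.comp (-X)).natDegree = p.natDegree := by
  rw [natDegree_comp, natDegree_neg, natDegree_X, mul_one]

theorem comp_neg_X_ne_zero {p : ℝ[X]} (hp : p ≠ 0) : p.comp (-X) ≠ 0 := by
  intro h
  apply hp
  rw [← comp_X (p := p), ← neg_neg (X : ℝ[X])]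
  have := congrArg (fun q => q.comp (-X)) h
  simpa [comp_assoc] using this

theorem pairSeed_ne_zero (α : ℝ) (F₁ F₂ : Finset ℕ) (i : Fin (F₁.card + F₂.card)) :
    pairSeed α F₁ F₂ i ≠ 0 := by
  induction i using Fin.addCases with
  | left i => simpa [pairSeed] using laguerrePoly_ne_zero _ _
  | right i => simpa [pairSeed] using comp_neg_X_ne_zero (laguerrePoly_ne_zero _ _)

/-- Two rows of the same kind have different degrees, because they come from different elements of
the same index set. -/
theorem pairFlag_natDegree_injective (α : ℝ) (F₁ F₂ : Finset ℕ) :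
    Function.Injective fun i => (pairFlag F₁ F₂ i, (pairSeed α F₁ F₂ i).natDegree) := by
  intro i i' h
  induction i using Fin.addCases <;> induction i' using Fin.addCases <;>
    simp_all [pairFlag, pairSeed, natDegree_laguerrePoly, natDegree_comp_neg_X]

theorem pairFlag_cons_natDegree_injective (α : ℝ) (F₁ F₂ : Finset ℕ) {m : ℕ} (hm : m ∉ F₁) :
    Function.Injective fun i : Fin (F₁.card + F₂.card + 1) =>
      ((Fin.cons false (pairFlag F₁ F₂) : Fin (F₁.card + F₂.card + 1) → Bool) i,
        ((Fin.cons (laguerrePoly α m) (pairSeed α F₁ F₂) :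
          Fin (F₁.card + F₂.card + 1) → ℝ[X]) i).natDegree) := by
  have hne : ∀ i, (false, m) ≠ (pairFlag F₁ F₂ i, (pairSeed α F₁ F₂ i).natDegree) := by
    intro i h
    induction i using Fin.addCases with
    | left i =>
      simp only [pairFlag, pairSeed, Fin.append_left, natDegree_laguerrePoly, Prod.mk.injEq,
        true_and] at h
      exact hm (h ▸ F₁.orderEmbOfFin_mem rfl i)
    | right i => simp [pairFlag] at h
  intro i i' h
  induction i using Fin.cases with
  | zero =>
    induction i' using Fin.cases with
    | zero => rfl
    | succ i' =>
      simp only [Fin.cons_zero, Fin.cons_succ, natDegree_laguerrePoly] at h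
      exact absurd h (hne i')
  | succ i =>
    induction i' using Fin.cases with
    | zero =>
      simp only [Fin.cons_zero, Fin.cons_succ, natDegree_laguerrePoly] at h
      exact absurd h.symm (hne i)
    | succ i' =>
      simp only [Fin.cons_succ] at h
      rw [pairFlag_natDegree_injective α F₁ F₂ h]

theorem omegaPoly_ne_zero (α : ℝ) (F₁ F₂ : Finset ℕ) : omegaPoly α F₁ F₂ ≠ 0 := by
  rw [omegaPoly_eq_det_twistedJet]
  exact det_twistedJet_ne_zero (pairSeed_ne_zero α F₁ F₂) (pairFlag_natDegree_injective α F₁ F₂)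

theorem exceptionalLaguerre_ne_zero (α : ℝ) {F₁ F₂ : Finset ℕ} {n : ℕ}
    (hn : n - uIndex F₁ F₂ ∉ F₁) : exceptionalLaguerre α F₁ F₂ n ≠ 0 := by
  rw [exceptionalLaguerre_eq_det_twistedJet]
  refine det_twistedJet_ne_zero (fun i => ?_) (pairFlag_cons_natDegree_injective α F₁ F₂ hn)
  induction i using Fin.cases with
  | zero => exact laguerrePoly_ne_zero _ _
  | succ i => exact pairSeed_ne_zero α F₁ F₂ i

/-! ### Eigenfunctions of the Laguerre operator and their Wronskian -/

/-- Extracting the weights of the rows turns a Wronskian into a polynomial determinant. -/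
theorem wronskianDet_expWeight_mul {k : ℕ} (b : Fin k → Bool) (p : Fin k → ℝ[X]) (x₀ : ℝ) :
    wronskianDet (PowerSeries.derivative ℝ) (fun i => expWeight (b i) * taylorSeries x₀ (p i))
      = (∏ i, expWeight (b i)) * taylorSeries x₀
        (Matrix.det (Matrix.of fun i j : Fin k => twistedJet (b i) (p i) j)) := by
  simp only [wronskianDet, iterate_derivative_expWeight_mul]
  have h := Matrix.det_mul_column (fun i => expWeight (b i))
    (Matrix.of fun i j : Fin k => taylorSeries x₀ (twistedJet (b i) (p i) j))
  rw [AlgHom.map_det]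
  exact h

theorem derivative_prod_expWeight_pairFlag (F₁ F₂ : Finset ℕ) :
    PowerSeries.derivative ℝ (∏ i, expWeight (pairFlag F₁ F₂ i))
      = F₂.card * ∏ i, expWeight (pairFlag F₁ F₂ i) := by
  have h : ∏ i, expWeight (pairFlag F₁ F₂ i) = PowerSeries.exp ℝ ^ F₂.card := by
    rw [Fin.prod_univ_add]
    simp [pairFlag, expWeight]
  rw [h, Derivation.leibniz_pow, PowerSeries.derivative_exp]
  cases F₂.card with
  | zero => simp
  | succ m =>
    rw [Nat.add_sub_cancel, smul_eq_mul, nsmul_eq_mul, pow_succ]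

theorem laguerre_eigenfunction (α : ℝ) (n : ℕ) (x₀ : ℝ) :
    taylorSeries x₀ X * PowerSeries.derivative ℝ (PowerSeries.derivative ℝ
        (taylorSeries x₀ (laguerrePoly α n)))
      + taylorSeries x₀ (C (α + 1) - X) * PowerSeries.derivative ℝ
        (taylorSeries x₀ (laguerrePoly α n))
      = taylorSeries x₀ (C (-(n : ℝ))) * taylorSeries x₀ (laguerrePoly α n) := by
  rw [derivative_taylorSeries, derivative_taylorSeries, ← map_mul, ← map_mul, ← map_mul,
    ← map_add, laguerrePoly_ode]

/-- The function `e^x L_n^α(-x)` is an eigenfunction of the Laguerre operator with eigenvalue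
`n + α + 1`. -/
theorem laguerre_exp_eigenfunction (α : ℝ) (n : ℕ) (x₀ : ℝ) :
    taylorSeries x₀ X * PowerSeries.derivative ℝ (PowerSeries.derivative ℝ
        (expWeight true * taylorSeries x₀ ((laguerrePoly α n).comp (-X))))
      + taylorSeries x₀ (C (α + 1) - X) * PowerSeries.derivative ℝ
        (expWeight true * taylorSeries x₀ ((laguerrePoly α n).comp (-X)))
      = taylorSeries x₀ (C (n + α + 1))
        * (expWeight true * taylorSeries x₀ ((laguerrePoly α n).comp (-X))) := by
  rw [derivative_expWeight_mul, derivative_expWeight_mul, mul_left_comm,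
    mul_left_comm (taylorSeries x₀ (C (α + 1) - X)), mul_left_comm (taylorSeries x₀ (C _)),
    ← mul_add, ← map_mul, ← map_mul, ← map_mul, ← map_add]
  congr 2
  have h := congrArg (fun q => q.comp (-X)) (laguerrePoly_ode α n)
  simp only [add_comp, mul_comp, sub_comp, X_comp, C_comp] at h
  simp only [if_true, derivative_comp_neg_X, derivative_add, derivative_neg, neg_neg]
  simp only [C_add, C_neg, C_1] at h ⊢
  linear_combination -h

theorem pairSeed_eigenfunction (α : ℝ) (F₁ F₂ : Finset ℕ) (x₀ : ℝ)
    (i : Fin (F₁.card + F₂.card)) :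
    ∃ c : ℝ, taylorSeries x₀ X * PowerSeries.derivative ℝ (PowerSeries.derivative ℝ
        (expWeight (pairFlag F₁ F₂ i) * taylorSeries x₀ (pairSeed α F₁ F₂ i)))
      + taylorSeries x₀ (C (α + 1) - X) * PowerSeries.derivative ℝ
        (expWeight (pairFlag F₁ F₂ i) * taylorSeries x₀ (pairSeed α F₁ F₂ i))
      = taylorSeries x₀ (C c)
        * (expWeight (pairFlag F₁ F₂ i) * taylorSeries x₀ (pairSeed α F₁ F₂ i)) := by
  induction i using Fin.addCases with
  | left i =>
    simp only [pairFlag, pairSeed, Fin.append_left, expWeight, Bool.false_eq_true, if_false,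
      one_mul]
    exact ⟨_, laguerre_eigenfunction _ _ _⟩
  | right i =>
    simp only [pairFlag, pairSeed, Fin.append_right]
    exact ⟨_, laguerre_exp_eigenfunction _ _ _⟩

/-! ### The differential equation of the exceptional Laguerre polynomials -/

/-- The eigenvalue equation, expanded at a point `x₀` where `Ω` does not vanish; `ω` is the
logarithmic derivative of `Ω`. It is Crum's transformed equation for the quotient of the two
determinants, conjugated by `Ω`. -/
theorem exceptionalLaguerre_ode_taylorSeries (α : ℝ) (F₁ F₂ : Finset ℕ) (n : ℕ) {x₀ : ℝ}
    (hΩ : (omegaPoly α F₁ F₂).eval x₀ ≠ 0) {ω : PowerSeries ℝ}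
    (hω : taylorSeries x₀ (derivative (omegaPoly α F₁ F₂))
      = ω * taylorSeries x₀ (omegaPoly α F₁ F₂)) :
    taylorSeries x₀ X
        * taylorSeries x₀ (derivative (derivative (exceptionalLaguerre α F₁ F₂ n)))
      + (taylorSeries x₀ (C (α + 1) - X) + (F₁.card + F₂.card) - 2 * taylorSeries x₀ X * ω)
        * taylorSeries x₀ (derivative (exceptionalLaguerre α F₁ F₂ n))
      + (-F₁.card + (1 - F₁.card - F₂.card - taylorSeries x₀ (C (α + 1) - X)) * ω
          + taylorSeries x₀ X * (PowerSeries.derivative ℝ ω + ω ^ 2))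
        * taylorSeries x₀ (exceptionalLaguerre α F₁ F₂ n)
      = taylorSeries x₀ (C (-((n - uIndex F₁ F₂ : ℕ) : ℝ)))
        * taylorSeries x₀ (exceptionalLaguerre α F₁ F₂ n) := by
  set m := n - uIndex F₁ F₂ with hm
  set k := F₁.card + F₂.card with hk
  set f : Fin k → PowerSeries ℝ := fun i =>
    expWeight (pairFlag F₁ F₂ i) * taylorSeries x₀ (pairSeed α F₁ F₂ i) with hf
  set E : PowerSeries ℝ := ∏ i, expWeight (pairFlag F₁ F₂ i) with hE
  set Ω := omegaPoly α F₁ F₂ with hΩdef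
  set P := exceptionalLaguerre α F₁ F₂ n with hP
  have hEunit : IsUnit E := by
    rw [hE, IsUnit.prod_univ_iff]
    exact fun i => isUnit_expWeight _
  have hW : wronskianDet (PowerSeries.derivative ℝ) f = E * taylorSeries x₀ Ω := by
    rw [hf, wronskianDet_expWeight_mul, hΩdef, omegaPoly_eq_det_twistedJet]
  have hWunit : IsUnit (wronskianDet (PowerSeries.derivative ℝ) f) := by
    rw [hW]
    refine hEunit.mul (PowerSeries.isUnit_iff_constantCoeff.2 ?_)
    rw [constantCoeff_taylorSeries]
    exact hΩ.isUnit
  have hDW : PowerSeries.derivative ℝ (wronskianDet (PowerSeries.derivative ℝ) f)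
      = (F₂.card + ω) * wronskianDet (PowerSeries.derivative ℝ) f := by
    rw [hW, Derivation.leibniz, derivative_taylorSeries, hω, hE,
      derivative_prod_expWeight_pairFlag, smul_eq_mul, smul_eq_mul]
    ring
  -- `ψ` is the image of `L_m^α` under the annihilating operator, and `P = ± Ω ψ`
  obtain ⟨a, ha, hann⟩ := exists_annihilator hWunit
  choose c hc using pairSeed_eigenfunction α F₁ F₂ x₀
  have hconst : ∀ r : ℝ, PowerSeries.derivative ℝ (taylorSeries x₀ (C r)) = 0 := by
    intro r
    rw [derivative_taylorSeries, derivative_C, map_zero]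
  have hDp : PowerSeries.derivative ℝ (taylorSeries x₀ X) = 1 := by
    rw [derivative_taylorSeries, derivative_X, map_one]
  have hDq : PowerSeries.derivative ℝ (taylorSeries x₀ (C (α + 1) - X)) = -1 := by
    rw [derivative_taylorSeries, derivative_sub, derivative_C, derivative_X, zero_sub, map_neg,
      map_one]
  have hcrum := crum_transform (by rw [hDp, Derivation.map_one_eq_zero])
    (by rw [hDq, map_neg, Derivation.map_one_eq_zero, neg_zero]) hWunit hDW
    (fun i => hconst (c i)) hc ha hann (hconst (-(m : ℝ))) (laguerre_eigenfunction α m x₀)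
  set ψ := ∑ j ∈ Finset.range (k + 1),
    a j * (PowerSeries.derivative ℝ)^[j] (taylorSeries x₀ (laguerrePoly α m)) with hψ
  have hPdet : P = Matrix.det (Matrix.of fun i j : Fin (k + 1) =>
      twistedJet ((Fin.cons false (pairFlag F₁ F₂) : Fin (k + 1) → Bool) i)
        ((Fin.cons (laguerrePoly α m) (pairSeed α F₁ F₂) : Fin (k + 1) → ℝ[X]) i) j) :=
    exceptionalLaguerre_eq_det_twistedJet α F₁ F₂ n
  have hPψ : taylorSeries x₀ P = (-1) ^ k * taylorSeries x₀ Ω * ψ := by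
    have h1 := wronskianDet_cons ha hann (taylorSeries x₀ (laguerrePoly α m))
    have h2 : (Fin.cons (taylorSeries x₀ (laguerrePoly α m)) f : Fin (k + 1) → PowerSeries ℝ)
        = fun i => expWeight ((Fin.cons false (pairFlag F₁ F₂) : Fin (k + 1) → Bool) i)
          * taylorSeries x₀ ((Fin.cons (laguerrePoly α m) (pairSeed α F₁ F₂) :
            Fin (k + 1) → ℝ[X]) i) := by
      funext i
      induction i using Fin.cases with
      | zero => simp [expWeight]
      | succ i => simp [hf]
    rw [h2, wronskianDet_expWeight_mul, Fin.prod_univ_succ, hW] at h1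
    simp only [Fin.cons_zero, Fin.cons_succ] at h1
    rw [← hE, ← hPdet] at h1
    refine hEunit.mul_left_cancel ?_
    simp only [expWeight, Bool.false_eq_true, if_false, one_mul] at h1
    rw [h1]
    ring
  have hs : PowerSeries.derivative ℝ ((-1) ^ k : PowerSeries ℝ) = 0 := by
    rw [Derivation.leibniz_pow, map_neg, Derivation.map_one_eq_zero, neg_zero, smul_zero,
      smul_zero]
  have hP1 : taylorSeries x₀ (derivative P)
      = (-1) ^ k * taylorSeries x₀ Ω * (ω * ψ + PowerSeries.derivative ℝ ψ) := by
    rw [← derivative_taylorSeries, hPψ, Derivation.leibniz, Derivation.leibniz, hs,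
      derivative_taylorSeries, hω]
    simp only [smul_eq_mul]
    ring
  have hP2 : taylorSeries x₀ (derivative (derivative P))
      = (-1) ^ k * taylorSeries x₀ Ω * (ω ^ 2 * ψ + PowerSeries.derivative ℝ ω * ψ
        + 2 * ω * PowerSeries.derivative ℝ ψ
        + PowerSeries.derivative ℝ (PowerSeries.derivative ℝ ψ)) := by
    rw [← derivative_taylorSeries, hP1, Derivation.leibniz, Derivation.leibniz, hs,
      derivative_taylorSeries, hω, map_add, Derivation.leibniz]
    simp only [smul_eq_mul]
    ring
  rw [hP2, hP1, hPψ]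
  have hDw : PowerSeries.derivative ℝ (F₂.card + ω) = PowerSeries.derivative ℝ ω := by
    rw [map_add, Derivation.map_natCast, zero_add]
  have hkcast : (k : PowerSeries ℝ) = F₁.card + F₂.card := by rw [hk, Nat.cast_add]
  rw [hDp, hDq, hDw, hkcast] at hcrum
  linear_combination (-1) ^ k * taylorSeries x₀ Ω * hcrum

theorem laguerreOperator_exceptionalLaguerre (α : ℝ) {F₁ F₂ : Finset ℕ} {n : ℕ}
    (hn : uIndex F₁ F₂ ≤ n) {x : ℝ} (hx : (omegaPoly α F₁ F₂).eval x ≠ 0) :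
    laguerreOperator α F₁ F₂ (fun t => (exceptionalLaguerre α F₁ F₂ n).eval t) x
      = -(n : ℝ) * (exceptionalLaguerre α F₁ F₂ n).eval x := by
  have hunit : IsUnit (taylorSeries x (omegaPoly α F₁ F₂)) := by
    rw [PowerSeries.isUnit_iff_constantCoeff, constantCoeff_taylorSeries]
    exact hx.isUnit
  obtain ⟨ω, hω⟩ := hunit.dvd (a := taylorSeries x (derivative (omegaPoly α F₁ F₂)))
  rw [mul_comm] at hω
  have hω' : taylorSeries x (derivative (derivative (omegaPoly α F₁ F₂)))
      = (PowerSeries.derivative ℝ ω + ω ^ 2) * taylorSeries x (omegaPoly α F₁ F₂) := by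
    rw [← derivative_taylorSeries, hω, Derivation.leibniz, derivative_taylorSeries, hω]
    simp only [smul_eq_mul]
    ring
  have hode := congrArg PowerSeries.constantCoeff
    (exceptionalLaguerre_ode_taylorSeries α F₁ F₂ n hx hω)
  have h1 := congrArg PowerSeries.constantCoeff hω
  have h2 := congrArg PowerSeries.constantCoeff hω'
  simp only [map_add, map_sub, map_mul, map_neg, map_one, map_natCast, map_ofNat, map_pow,
    constantCoeff_taylorSeries, eval_X, eval_C] at hode h1 h2
  have hd : deriv (fun t => (exceptionalLaguerre α F₁ F₂ n).eval t)
      = fun t => (derivative (exceptionalLaguerre α F₁ F₂ n)).eval t :=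
    funext fun t => Polynomial.deriv _
  rw [laguerreOperator, hd, Polynomial.deriv, coeffOne, coeffZero,
    ← (eq_div_iff hx).2 h1.symm, ← (eq_div_iff hx).2 h2.symm]
  rw [Nat.cast_sub hn] at hode
  push_cast
  linear_combination hode

theorem mainTheorem7 (α : ℤ) (hα : α < 0) (F₁ F₂ : Finset ℕ)
    (hF₁ : ∀ f ∈ F₁, 0 < f) (hF₂ : ∀ f ∈ F₂, 0 < f) :
    omegaPoly (α : ℝ) F₁ F₂ ≠ 0 ∧
    ∀ n ∈ sigmaIndex F₁ F₂,
      exceptionalLaguerre (α : ℝ) F₁ F₂ n ≠ 0 ∧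
      ∀ x : ℝ, (omegaPoly (α : ℝ) F₁ F₂).eval x ≠ 0 →
        laguerreOperator (α : ℝ) F₁ F₂
            (fun t => (exceptionalLaguerre (α : ℝ) F₁ F₂ n).eval t) x
          = -(n : ℝ) * (exceptionalLaguerre (α : ℝ) F₁ F₂ n).eval x := by
  refine ⟨omegaPoly_ne_zero _ _ _, fun n hn => ?_⟩
  obtain ⟨hle, hgap⟩ := hn
  replace hle : uIndex F₁ F₂ ≤ n := hle
  exact ⟨exceptionalLaguerre_ne_zero _ fun h => hgap ⟨_, h, by omega⟩,
    fun x hx => laguerreOperator_exceptionalLaguerre _ hle hx⟩
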